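/- Let $Z$ be a complex normed space with dual $U=Z^*$ and closed unit ball $Z_1$. Write $f\perp g$ if $\|f+g\|=\|f-g\|=\|f\|+\|g\|$, and for $S\subset Z$ let $S^\perp$ be the set of all $g$ with $f\perp g$ for every $f\in S$. A norm exposed face is a non-empty set $F_x=\{f\in Z_1: x(f)=1\}$ with $x\in U$, $\|x\|=1$. A norm exposed face $F$ is symmetric if there is a linear isometry $S_F$ of $Z$ onto $Z$ with $S_F^2=I$ whose fixed point set is the topological direct sum $\overline{\mathrm{sp}}\,F\oplus F^\perp$ (such an $S_F$ is unique). For such $F$, $P_2(F)$ and $P_0(F)$ denote the projections of $Z$ onto $\overline{\mathrm{sp}}\,F$ and $F^\perp$ with $P_2(F)+P_0(F)=(I+S_F)/2$. $Z$ is strongly facially symmetric if every norm exposed face $F$ is symmetric and $S_F^*y=y$ whenever $y\in U$, $\|y\|=1$ and $F\subset F_y$. $Z$ is neutral if for every symmetric face $F$ and every $f\in Z$, $\|P_2(F)f\|=\|f\|$ implies $P_2(F)f=f$. A geometric tripotent is a $u\in U$ with $\|u\|=1$ which vanishes on $F_u^\perp$, for which $F_u$ is a symmetric face and $S_{F_u}^*u=u$.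 Put $S_u=S_{F_u}$, $P_k(u)=P_k(F_u)$, $Z_k(u)=P_k(u)(Z)$ and $U_k(u)=P_k(u)^*(U)$ for $k=0,2$. Geometric tripotents $u,v$ are orthogonal if $u\in U_0(v)$, and $u$ is minimal if $\dim U_2(u)=1$. $Z$ satisfies JP if $S_uS_v=S_{u+v}$ for every pair $u,v$ of orthogonal geometric tripotents. **Proposition.** Let $Z$ be a neutral strongly facially symmetric space satisfying JP, and let $\{u_i\}_{i\in I}$ be an arbitrary family of mutually orthogonal minimal geometric tripotents. Then the projections $P_0(u_i)$ commute with each other and $Q:=\prod_{i\in I}P_0(u_i)$ exists as a strong limit: there is a bounded linear operator $Q$ on $Z$ such that, for each $f\in Z$, the net $\prod_{i\in A}P_0(u_i)f$, indexed by the finite subsets $A$ of $I$ directed by inclusion, converges in norm to $Qf$. Moreover $Q$ is a contractive projection ($\|Q\|\le 1$, $Q^2=Q$) with range $\bigcap_{i\in I}Z_0(u_i)$. -/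

import Mathlib

open Filter Topology

namespace FacialSymmetry

variable {Z : Type*} [NormedAddCommGroup Z] [NormedSpace ℂ Z]

/-- Orthogonality of two vectors: `‖f + g‖ = ‖f - g‖ = ‖f‖ + ‖g‖`. -/
def Orth (f g : Z) : Prop :=
  ‖f + g‖ = ‖f‖ + ‖g‖ ∧ ‖f - g‖ = ‖f‖ + ‖g‖

/-- `S^⊥`: the set of all vectors that are orthogonal to each element of `S`. -/
def orthCompl (S : Set Z) : Set Z := {g | ∀ f ∈ S, Orth f g}

/-- `F_x`: the elements of the closed unit ball at which the functional `x` takes the value 1. -/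
def face (x : StrongDual ℂ Z) : Set Z := {f | ‖f‖ ≤ 1 ∧ x f = 1}

/-- Norm exposed faces of the closed unit ball. -/
def IsNormExposedFace (F : Set Z) : Prop :=
  F.Nonempty ∧ ∃ x : StrongDual ℂ Z, ‖x‖ = 1 ∧ F = face x

/-- The norm closure of the complex linear span of `F`. -/
def closedSpan (F : Set Z) : Submodule ℂ Z := (Submodule.span ℂ F).topologicalClosure

/-- `S` is a symmetry (a surjective linear isometry with `S² = I`) whose fixed point set is the
topological direct sum of the closed span of `F` and of `F^⊥`.  The last field says that the
projection of the direct sum onto its first summand (hence also the one onto its second summand)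
is continuous. -/
structure IsFacialSymmetry (F : Set Z) (S : Z ≃ₗᵢ[ℂ] Z) : Prop where
  involutive : ∀ z, S (S z) = z
  fixed : ∃ N : Submodule ℂ Z, (N : Set Z) = orthCompl F ∧
    Disjoint (closedSpan F) N ∧
    (∀ z, S z = z ↔ z ∈ closedSpan F ⊔ N) ∧
    ∃ C : ℝ, ∀ a ∈ closedSpan F, ∀ n ∈ N, ‖a‖ ≤ C * ‖a + n‖

/-- Symmetric faces. -/
def IsSymmetricFace (F : Set Z) : Prop :=
  IsNormExposedFace F ∧ ∃ S : Z ≃ₗᵢ[ℂ] Z, IsFacialSymmetry F S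

/-- The symmetry belonging to a face is unique. -/
theorem IsFacialSymmetry.unique {F : Set Z} {S T : Z ≃ₗᵢ[ℂ] Z}
    (hS : IsFacialSymmetry F S) (hT : IsFacialSymmetry F T) : S = T := by
  have hfix : ∀ z, S z = z ↔ T z = z := by
    obtain ⟨N, hN, -, h, -⟩ := hS.fixed
    obtain ⟨N', hN', -, h', -⟩ := hT.fixed
    have : N = N' := SetLike.coe_injective (hN.trans hN'.symm)
    subst this
    exact fun z => (h z).trans (h' z).symm
  ext z
  -- `d` is fixed by both, and `(S ∘ T)^n z = z + n d` stays bounded.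
  have h1 : T (z + S z) = z + S z := (hfix _).1 (by rw [map_add, hS.involutive, add_comm])
  have h2 : S (z + T z) = z + T z := (hfix _).2 (by rw [map_add, hT.involutive, add_comm])
  set d := T z - S z with hd
  have hTz : T z = S z + d := by rw [hd]; abel
  have hSd : S d = d := by
    have := h2
    rw [hTz, map_add, map_add, hS.involutive] at this
    have h3 : S z + (z + S d) = S z + (z + d) := by rw [this]; abel
    exact add_left_cancel (add_left_cancel h3)
  have hTd : T d = d := (hfix d).1 hSd
  have hST : S (T z) = z + d := by rw [hTz, map_add, hS.involutive, hSd]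
  have hn : ∀ n : ℕ, ‖z + n • d‖ = ‖z‖ := by
    intro n
    induction n with
    | zero => simp
    | succ n ih =>
      have : S (T (z + n • d)) = z + (n + 1) • d := by
        rw [map_add, map_add, map_nsmul, map_nsmul, hTd, hSd, hST, add_smul, one_smul]
        abel
      rw [← this, S.norm_map, T.norm_map, ih]
  have hd0 : d = 0 := by
    by_contra hne
    have hpos : 0 < ‖d‖ := norm_pos_iff.2 hne
    obtain ⟨n, hn'⟩ := exists_nat_gt (2 * ‖z‖ / ‖d‖)
    have h4 : ‖(n : ℕ) • d‖ ≤ 2 * ‖z‖ := by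
      have : n • d = (z + n • d) - z := by abel
      rw [this]
      refine (norm_sub_le _ _).trans ?_
      rw [hn n]; linarith
    rw [← Nat.cast_smul_eq_nsmul ℝ, norm_smul, Real.norm_natCast] at h4
    rw [div_lt_iff₀ hpos] at hn'
    linarith
  rw [hTz, hd0, add_zero]

/-- `P₂` and `P₀` are the projections onto the closed span of `F` and onto `F^⊥`, with
`P₂ + P₀ = (I + S) / 2`. -/
structure IsPeircePair (F : Set Z) (S : Z ≃ₗᵢ[ℂ] Z) (P₂ P₀ : Z →L[ℂ] Z) : Prop where
  proj_two : ∀ z, P₂ (P₂ z) = P₂ z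
  range_two : Set.range P₂ = closedSpan F
  proj_zero : ∀ z, P₀ (P₀ z) = P₀ z
  range_zero : Set.range P₀ = orthCompl F
  sum : ∀ z, P₂ z + P₀ z = (2⁻¹ : ℂ) • (z + S z)

theorem IsFacialSymmetry.exists_peircePair {F : Set Z} {S : Z ≃ₗᵢ[ℂ] Z}
    (hS : IsFacialSymmetry F S) :
    ∃ P : (Z →L[ℂ] Z) × (Z →L[ℂ] Z), IsPeircePair F S P.1 P.2 := by
  obtain ⟨N, hN, hdis, hfix, C, hC⟩ := hS.fixed
  set A := closedSpan F with hA
  have hmem : ∀ z, (2⁻¹ : ℂ) • (z + S z) ∈ A ⊔ N := fun z => by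
    rw [← hfix, map_smul, map_add, hS.involutive, add_comm]
  have hself : ∀ z, z ∈ A ⊔ N → (2⁻¹ : ℂ) • (z + S z) = z := fun z hz => by
    rw [(hfix z).2 hz, ← two_smul ℂ z, smul_smul]; norm_num
  have huniq : ∀ w a b : Z, a ∈ A → b ∈ A → w - a ∈ N → w - b ∈ N → a = b := by
    intro w a b ha hb hwa hwb
    have h1 : a - b ∈ N := by
      have := N.sub_mem hwb hwa
      rwa [sub_sub_sub_cancel_left] at this
    exact sub_eq_zero.1 (Submodule.disjoint_def.1 hdis _ (A.sub_mem ha hb) h1)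
  have hex : ∀ z, ∃ a ∈ A, (2⁻¹ : ℂ) • (z + S z) - a ∈ N := by
    intro z
    obtain ⟨a, ha, n, hn, h⟩ := Submodule.mem_sup.1 (hmem z)
    exact ⟨a, ha, by rw [← h]; simpa using hn⟩
  choose p hpA hpN using hex
  let L : Z →ₗ[ℂ] Z :=
    { toFun := p
      map_add' := fun x y => by
        refine huniq _ _ _ (hpA _) (A.add_mem (hpA x) (hpA y)) (hpN _) ?_
        have := N.add_mem (hpN x) (hpN y)
        convert this using 1
        rw [map_add]; module
      map_smul' := fun c x => by
        refine huniq _ _ _ (hpA _) (A.smul_mem c (hpA x)) (hpN _) ?_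
        have := N.smul_mem c (hpN x)
        convert this using 1
        rw [map_smul, RingHom.id_apply]; module }
  have hbound : ∀ z, ‖L z‖ ≤ |C| * ‖z‖ := by
    intro z
    have h1 := hC _ (hpA z) _ (hpN z)
    rw [add_sub_cancel] at h1
    have h2 : ‖(2⁻¹ : ℂ) • (z + S z)‖ ≤ ‖z‖ := by
      rw [norm_smul]
      have := norm_add_le z (S z)
      rw [S.norm_map] at this
      norm_num
      linarith
    calc ‖L z‖ ≤ C * ‖(2⁻¹ : ℂ) • (z + S z)‖ := h1
      _ ≤ |C| * ‖(2⁻¹ : ℂ) • (z + S z)‖ := by gcongr; exact le_abs_self C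
      _ ≤ |C| * ‖z‖ := by gcongr
  let P₂ : Z →L[ℂ] Z := L.mkContinuous |C| hbound
  let P₀ : Z →L[ℂ] Z :=
    (2⁻¹ : ℂ) • (ContinuousLinearMap.id ℂ Z + (S : Z →L[ℂ] Z)) - P₂
  have e₂ : ∀ z, P₂ z = p z := fun z => rfl
  have e₀ : ∀ z, P₀ z = (2⁻¹ : ℂ) • (z + S z) - p z := fun z => rfl
  have pA : ∀ a ∈ A, p a = a := fun a ha => by
    refine huniq _ _ _ (hpA a) ha (hpN a) ?_
    rw [hself a (Submodule.mem_sup_left ha), sub_self]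
    exact N.zero_mem
  have pN : ∀ n ∈ N, p n = 0 := fun n hn => by
    refine huniq _ _ _ (hpA n) A.zero_mem (hpN n) ?_
    rw [hself n (Submodule.mem_sup_right hn), sub_zero]
    exact hn
  have qN : ∀ n ∈ N, P₀ n = n := fun n hn => by
    rw [e₀, pN n hn, hself n (Submodule.mem_sup_right hn), sub_zero]
  refine ⟨(P₂, P₀), ?_, ?_, ?_, ?_, ?_⟩
  · intro z
    exact pA _ (hpA z)
  · ext a
    constructor
    · rintro ⟨z, rfl⟩
      exact hpA z
    · exact fun ha => ⟨a, pA a ha⟩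
  · intro z
    exact qN _ (hpN z)
  · rw [← hN]
    ext n
    constructor
    · rintro ⟨z, rfl⟩
      exact hpN z
    · exact fun hn => ⟨n, qN n hn⟩
  · intro z
    change P₂ z + P₀ z = _
    rw [e₀, e₂]
    abel

open Classical in
/-- `S_F`: the symmetry belonging to a symmetric face `F` (the identity if `F` has none). -/
noncomputable def faceSymmetry (F : Set Z) : Z ≃ₗᵢ[ℂ] Z :=
  if h : ∃ S : Z ≃ₗᵢ[ℂ] Z, IsFacialSymmetry F S then h.choose
  else LinearIsometryEquiv.refl ℂ Z

open Classical in
/-- The geometric Peirce projections `(P₂(F), P₀(F))` of a symmetric face `F`. -/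
noncomputable def peircePair (F : Set Z) : (Z →L[ℂ] Z) × (Z →L[ℂ] Z) :=
  if h : ∃ P : (Z →L[ℂ] Z) × (Z →L[ℂ] Z), IsPeircePair F (faceSymmetry F) P.1 P.2 then h.choose
  else 0

/-- `P₂(F)`. -/
noncomputable def peirceTwo (F : Set Z) : Z →L[ℂ] Z := (peircePair F).1

/-- `P₀(F)`. -/
noncomputable def peirceZero (F : Set Z) : Z →L[ℂ] Z := (peircePair F).2

theorem isFacialSymmetry_faceSymmetry {F : Set Z} (hF : IsSymmetricFace F) :
    IsFacialSymmetry F (faceSymmetry F) := by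
  rw [faceSymmetry, dif_pos hF.2]
  exact hF.2.choose_spec

theorem isPeircePair_peirce {F : Set Z} (hF : IsSymmetricFace F) :
    IsPeircePair F (faceSymmetry F) (peirceTwo F) (peirceZero F) := by
  have h := (isFacialSymmetry_faceSymmetry hF).exists_peircePair
  rw [peirceTwo, peirceZero, peircePair, dif_pos h]
  exact h.choose_spec

/-- The range `U_k = P^*(Z^*)` of the adjoint of an operator `P` on `Z`. -/
noncomputable def adjointRange (P : Z →L[ℂ] Z) : Submodule ℂ (StrongDual ℂ Z) :=
  LinearMap.range (P.precomp ℂ : StrongDual ℂ Z →L[ℂ] StrongDual ℂ Z).toLinearMap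

/-- Projective units: norm one functionals `u` that vanish on `F_u^⊥`. -/
def IsProjectiveUnit (u : StrongDual ℂ Z) : Prop :=
  ‖u‖ = 1 ∧ ∀ g ∈ orthCompl (face u), u g = 0

/-- Geometric tripotents: projective units `u` for which `F_u` is a symmetric face and
`S_{F_u}^* u = u`. -/
def IsGeometricTripotent (u : StrongDual ℂ Z) : Prop :=
  IsProjectiveUnit u ∧ IsSymmetricFace (face u) ∧ ∀ z, u (faceSymmetry (face u) z) = u z

/-- Orthogonality of geometric tripotents: `u ∈ U₀(v)`. -/
def TripotentOrth (u v : StrongDual ℂ Z) : Prop := u ∈ adjointRange (peirceZero (face v))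

/-- Minimal geometric tripotents: `U₂(v)` is one dimensional. -/
def IsMinimalTripotent (v : StrongDual ℂ Z) : Prop :=
  IsGeometricTripotent v ∧ Module.finrank ℂ (adjointRange (peirceTwo (face v))) = 1

variable (Z)

/-- Weakly facially symmetric spaces. -/
def IsWFS : Prop := ∀ F : Set Z, IsNormExposedFace F → IsSymmetricFace F

/-- Strongly facially symmetric spaces. -/
def IsSFS : Prop :=
  IsWFS Z ∧ ∀ F : Set Z, IsNormExposedFace F → ∀ y : StrongDual ℂ Z, ‖y‖ = 1 → F ⊆ face y →
    ∀ z, y (faceSymmetry F z) = y z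

/-- Neutral spaces: for each symmetric face `F`, the contractive projection `P₂(F)` is neutral. -/
def IsNeutral : Prop :=
  ∀ F : Set Z, IsSymmetricFace F → ∀ z : Z, ‖peirceTwo F z‖ = ‖z‖ → peirceTwo F z = z

/-- The property JP: `S_u S_v = S_{u+v}` for orthogonal geometric tripotents `u`, `v`. -/
def SatisfiesJP : Prop :=
  ∀ u v : StrongDual ℂ Z, IsGeometricTripotent u → IsGeometricTripotent v → TripotentOrth u v →
    ∀ z, faceSymmetry (face u) (faceSymmetry (face v) z) = faceSymmetry (face (u + v)) z

end FacialSymmetry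

/-!
The weak-star sum `s` of the tripotents `u_i` exposes a face `F_s`, and `Q` is its Peirce
projection `P₀(F_s)`. As `F_s` is norm exposed, strong facial symmetry provides this projection on
`Z` itself, so that no completeness is needed for the limit to exist.

In a weakly facially symmetric space the vectors orthogonal to a given one form a closed subspace
(`IsWFS.orth_add_smul`). Hence the Peirce spaces `Z₂` and `Z₀` of a symmetric face form an
`ℓ¹`-sum, and `‖P₂ f‖ + ‖P₀ f‖ ≤ ‖f‖` (`IsWFS.norm_peirceTwo_add_norm_peirceZero_le`). Dually, a
geometric tripotent plus a contractive functional of its space `U₀` is contractive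
(`IsWFS.norm_tripotent_add_le`). Consequently `F_u ⊆ F_v^⊥` for orthogonal `u` and `v`, which
together with the uniqueness of facial symmetries gives commuting projections
(`IsWFS.commute_peirceZero`).

For the convergence, put `h = f - Q f`. A weak-star limit `v` of functionals that norm the finite
products at `h` is invariant under every `P₀(u_i)` (`tendsto_noncommProd_zero`). Therefore
`‖s ± v‖ ≤ 1` (`IsWFS.exists_weakStar_sum`), so `v` vanishes on `F_s` and `F_s ⊆ F_{s+v}`. Strong
facial symmetry makes `s` and `s + v`, and hence `v`, invariant under the symmetry of `F_s`, so
`v = v ∘ Q` (`IsSFS.apply_peirceZero_of_norm_add_sub_le`) and `v h = 0`. Thus the products tend to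
zero at `h`, while they fix `Q f`.
-/

namespace FacialSymmetry

/-! ### Orthogonality and norming functionals -/

section Norm

variable {Z : Type*} [NormedAddCommGroup Z]

theorem Orth.symm {f g : Z} (h : Orth f g) : Orth g f :=
  ⟨by rw [add_comm g f, h.1, add_comm], by rw [norm_sub_rev g f, h.2, add_comm]⟩

theorem orth_zero_left (f : Z) : Orth 0 f := by simp [Orth]

theorem orthCompl_anti {S T : Set Z} (h : S ⊆ T) : orthCompl T ⊆ orthCompl S :=
  fun _ hg f hf => hg f (h hf)

theorem isClosed_setOf_orth (f : Z) : IsClosed {g | Orth f g} :=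
  (isClosed_eq (by fun_prop) (by fun_prop)).inter (isClosed_eq (by fun_prop) (by fun_prop))

end Norm

section Functionals

variable {Z : Type*} [NormedAddCommGroup Z] [NormedSpace ℂ Z]

theorem le_norm_of_apply_eq {x : StrongDual ℂ Z} (hx : ‖x‖ ≤ 1) {f : Z} {r : ℝ}
    (h : x f = (r : ℂ)) : r ≤ ‖f‖ := by
  calc r ≤ ‖(r : ℂ)‖ := by simpa using le_abs_self r
    _ = ‖x f‖ := by rw [h]
    _ ≤ ‖f‖ := by simpa using x.le_of_opNorm_le hx f

theorem norm_eq_one_of_mem_face {x : StrongDual ℂ Z} (hx : ‖x‖ ≤ 1) {f : Z} (hf : f ∈ face x) :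
    ‖f‖ = 1 :=
  le_antisymm hf.1 (le_norm_of_apply_eq hx (by simpa using hf.2))

theorem norm_eq_one_of_face_nonempty {x : StrongDual ℂ Z} (hx : ‖x‖ ≤ 1) (h : (face x).Nonempty) :
    ‖x‖ = 1 := by
  obtain ⟨f, hf⟩ := h
  refine le_antisymm hx ?_
  have h1 := x.le_opNorm f
  rw [hf.2, norm_one, norm_eq_one_of_mem_face hx hf, mul_one] at h1
  exact h1

/-- The equality case of the triangle inequality for a functional of norm at most one. -/
theorem apply_eq_norm_of_apply_add {v : StrongDual ℂ Z} (hv : ‖v‖ ≤ 1) {f g : Z}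
    (h : v (f + g) = ((‖f‖ + ‖g‖ : ℝ) : ℂ)) : v f = ‖f‖ ∧ v g = ‖g‖ := by
  have hf : ‖v f‖ ≤ ‖f‖ := by simpa using v.le_of_opNorm_le hv f
  have hg : ‖v g‖ ≤ ‖g‖ := by simpa using v.le_of_opNorm_le hv g
  have hre : (v f).re + (v g).re = ‖f‖ + ‖g‖ := by
    have := congrArg Complex.re h
    rwa [map_add, Complex.add_re, Complex.ofReal_re] at this
  have h1 := Complex.re_le_norm (v f)
  have h2 := Complex.re_le_norm (v g)
  -- A complex number whose real part equals its modulus is that modulus.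
  have key : ∀ (c : ℂ) (r : ℝ), ‖c‖ ≤ r → c.re = r → c = r := by
    intro c r hc hr
    have him : c.im = 0 := by
      have := Complex.sq_norm c
      rw [Complex.normSq_apply] at this
      have h0 := norm_nonneg c
      nlinarith
    exact Complex.ext (by simpa using hr) (by simpa using him)
  exact ⟨key _ _ hf (by linarith), key _ _ hg (by linarith)⟩

/-- Orthogonal vectors are normed by functionals `x`, `y` that separate them and span an
`ℓ^∞`-sum: both `x + y` and `x - y` are contractive. -/
theorem Orth.exists_functionals {f g : Z} (h : Orth f g) :
    ∃ x y : StrongDual ℂ Z, ‖x‖ ≤ 1 ∧ ‖x + y‖ ≤ 1 ∧ ‖x - y‖ ≤ 1 ∧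
      x f = ‖f‖ ∧ x g = 0 ∧ y f = 0 ∧ y g = ‖g‖ := by
  obtain ⟨v, hv, hvf⟩ := exists_dual_vector'' ℂ (f + g)
  obtain ⟨w, hw, hwf⟩ := exists_dual_vector'' ℂ (f - g)
  obtain ⟨h1, h2⟩ := apply_eq_norm_of_apply_add hv (f := f) (g := g) (by rw [hvf, h.1]; rfl)
  obtain ⟨h3, h4⟩ := apply_eq_norm_of_apply_add hw (f := f) (g := -g)
    (by rw [← sub_eq_add_neg, hwf, h.2, norm_neg]; rfl)
  rw [map_neg, norm_neg, neg_eq_iff_eq_neg] at h4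
  refine ⟨(2⁻¹ : ℂ) • (v + w), (2⁻¹ : ℂ) • (v - w), ?_, ?_, ?_, ?_, ?_, ?_, ?_⟩
  · rw [norm_smul]
    have := norm_add_le v w
    norm_num
    linarith
  · convert hv using 2; module
  · convert hw using 2; module
  · simp only [smul_apply, add_apply, h1, h3, smul_eq_mul]; ring
  · simp [h2, h4]
  · simp [h1, h3]
  · simp only [smul_apply, sub_apply, h2, h4, smul_eq_mul]; ring

/-- If `x ± y` are contractive, then `y` vanishes on the face exposed by `x`. -/
theorem apply_eq_zero_of_mem_face {x y : StrongDual ℂ Z} (hadd : ‖x + y‖ ≤ 1) (hsub : ‖x - y‖ ≤ 1)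
    {f : Z} (hf : f ∈ face x) : y f = 0 := by
  have h1 : ‖1 + y f‖ ≤ 1 := by
    have := (x + y).le_of_opNorm_le_of_le hadd hf.1
    simpa [hf.2] using this
  have h2 : ‖1 - y f‖ ≤ 1 := by
    have := (x - y).le_of_opNorm_le_of_le hsub hf.1
    simpa [hf.2] using this
  have h3 := parallelogram_law_with_norm ℂ (1 : ℂ) (y f)
  rw [norm_one] at h3
  have h4 : ‖y f‖ = 0 := by
    nlinarith [norm_nonneg (y f), norm_nonneg (1 + y f), norm_nonneg (1 - y f)]
  exact norm_eq_zero.1 h4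

/-- A criterion for orthogonality by means of functionals. -/
theorem orth_of_functionals {x y : StrongDual ℂ Z} (hadd : ‖x + y‖ ≤ 1) (hsub : ‖x - y‖ ≤ 1)
    {f g : Z} (hxf : x f = ‖f‖) (hxg : x g = 0) (hyf : y f = 0) (hyg : y g = ‖g‖) : Orth f g := by
  constructor
  · refine le_antisymm (norm_add_le _ _) (le_norm_of_apply_eq hadd ?_)
    simp [hxf, hxg, hyf, hyg]
  · refine le_antisymm (norm_sub_le _ _) (le_norm_of_apply_eq hsub ?_)
    simp [hxf, hxg, hyf, hyg]

theorem Orth.smul_right {f g : Z} (h : Orth f g) {t : ℝ} (ht : 0 ≤ t) : Orth f ((t : ℂ) • g) := by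
  obtain ⟨x, y, -, hadd, hsub, hxf, hxg, hyf, hyg⟩ := h.exists_functionals
  refine orth_of_functionals hadd hsub hxf (by simp [hxg]) hyf ?_
  simp [hyg, norm_smul, abs_of_nonneg ht]

/-- Faces exposed by two functionals `x`, `y` with `x ± y` contractive are orthogonal. -/
theorem face_subset_orthCompl_face {x y : StrongDual ℂ Z} (hx : ‖x‖ ≤ 1) (hy : ‖y‖ ≤ 1)
    (hadd : ‖x + y‖ ≤ 1) (hsub : ‖x - y‖ ≤ 1) : face x ⊆ orthCompl (face y) := by
  intro f hf h hh
  refine (orth_of_functionals hadd hsub (f := f) (g := h) ?_ ?_ ?_ ?_).symm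
  · rw [hf.2, norm_eq_one_of_mem_face hx hf, Complex.ofReal_one]
  · exact apply_eq_zero_of_mem_face (by rwa [add_comm]) (by rwa [norm_sub_rev]) hh
  · exact apply_eq_zero_of_mem_face hadd hsub hf
  · rw [hh.2, norm_eq_one_of_mem_face hy hh, Complex.ofReal_one]

/-- A vector orthogonal to the unit vector `f` is orthogonal to a whole norm exposed face through
`f`. -/
theorem Orth.exists_face {f g : Z} (hf : ‖f‖ = 1) (h : Orth f g) :
    ∃ x : StrongDual ℂ Z, ‖x‖ ≤ 1 ∧ f ∈ face x ∧ g ∈ orthCompl (face x) := by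
  obtain ⟨x, y, hx, hadd, hsub, hxf, hxg, hyf, hyg⟩ := h.exists_functionals
  refine ⟨x, hx, ⟨hf.le, by rw [hxf, hf, Complex.ofReal_one]⟩, fun k hk => ?_⟩
  refine orth_of_functionals hadd hsub ?_ hxg (apply_eq_zero_of_mem_face hadd hsub hk) hyg
  rw [hk.2, norm_eq_one_of_mem_face hx hk, Complex.ofReal_one]

/-- Weak-star compactness of the dual unit ball, stated for limits along an ultrafilter. -/
theorem exists_weakStar_limit {α : Type*} (l : Ultrafilter α) (x : α → StrongDual ℂ Z)
    (hx : ∀ a, ‖x a‖ ≤ 1) :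
    ∃ v : StrongDual ℂ Z, ‖v‖ ≤ 1 ∧ ∀ f, Tendsto (fun a => x a f) l (𝓝 (v f)) := by
  have hc : ∀ f : Z, ∃ c : ℂ, Tendsto (fun a => x a f) l (𝓝 c) := by
    intro f
    obtain ⟨c, -, hc⟩ := (isCompact_closedBall (0 : ℂ) ‖f‖).ultrafilter_le_nhds
      (l.map fun a => x a f) (by
        rw [le_principal_iff]
        refine Filter.mem_map.2 (univ_mem' fun a => ?_)
        simpa using (x a).le_of_opNorm_le (hx a) f)
    exact ⟨c, hc⟩
  choose v hv using hc
  let V : Z →ₗ[ℂ] ℂ :=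
    { toFun := v
      map_add' := fun f g => tendsto_nhds_unique (hv (f + g))
        (by simpa only [map_add] using (hv f).add (hv g))
      map_smul' := fun c f => tendsto_nhds_unique (hv (c • f))
        (by simpa only [map_smul, RingHom.id_apply, smul_eq_mul] using (hv f).const_mul c) }
  have hb : ∀ f, ‖V f‖ ≤ 1 * ‖f‖ := fun f =>
    le_of_tendsto (hv f).norm (Eventually.of_forall fun a => (x a).le_of_opNorm_le (hx a) f)
  exact ⟨V.mkContinuous 1 hb, V.mkContinuous_norm_le zero_le_one hb, hv⟩

end Functionals

/-! ### Symmetric faces and their Peirce projections -/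

section Symmetric

variable {Z : Type*} [NormedAddCommGroup Z] [NormedSpace ℂ Z]

theorem IsSymmetricFace.exists_submodule {F : Set Z} (hF : IsSymmetricFace F) :
    ∃ N : Submodule ℂ Z, (N : Set Z) = orthCompl F := by
  obtain ⟨-, S, hS⟩ := hF
  obtain ⟨N, hN, -⟩ := hS.fixed
  exact ⟨N, hN⟩

theorem isNormExposedFace_face {x : StrongDual ℂ Z} (hx : ‖x‖ ≤ 1) (h : (face x).Nonempty) :
    IsNormExposedFace (face x) :=
  ⟨h, x, norm_eq_one_of_face_nonempty hx h, rfl⟩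

/-- In a weakly facially symmetric space the vectors orthogonal to a unit vector form a subspace:
any two of them are orthogonal to a common norm exposed face through that vector. -/
theorem IsWFS.orth_add_smul_of_norm_eq_one (hZ : IsWFS Z) {f g₁ g₂ : Z} (hf : ‖f‖ = 1)
    (h₁ : Orth f g₁) (h₂ : Orth f g₂) (c : ℂ) : Orth f (g₁ + c • g₂) := by
  obtain ⟨x₁, hx₁, hf₁, hg₁⟩ := h₁.exists_face hf
  obtain ⟨x₂, hx₂, hf₂, hg₂⟩ := h₂.exists_face hf
  set x : StrongDual ℂ Z := (2⁻¹ : ℂ) • (x₁ + x₂) with hxdef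
  have hx : ‖x‖ ≤ 1 := by
    rw [hxdef, norm_smul]
    have := norm_add_le x₁ x₂
    norm_num
    linarith
  have hfx : f ∈ face x := ⟨hf.le, by
    simp only [hxdef, smul_apply, add_apply, hf₁.2, hf₂.2, smul_eq_mul]; norm_num⟩
  -- The midpoint exposes the intersection of the two faces.
  have hsub : ∀ h ∈ face x, h ∈ face x₁ ∧ h ∈ face x₂ := by
    intro h hh
    have hd : ((2⁻¹ : ℂ) • (x₁ - x₂)) h = 0 := by
      refine apply_eq_zero_of_mem_face (x := x) ?_ ?_ hh
      · convert hx₁ using 2; rw [hxdef]; module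
      · convert hx₂ using 2; rw [hxdef]; module
    have e₁ : x₁ h = x h + ((2⁻¹ : ℂ) • (x₁ - x₂)) h := by
      rw [← add_apply]; congr 1; rw [hxdef]; module
    have e₂ : x₂ h = x h - ((2⁻¹ : ℂ) • (x₁ - x₂)) h := by
      rw [← sub_apply]; congr 1; rw [hxdef]; module
    exact ⟨⟨hh.1, by rw [e₁, hd, hh.2, add_zero]⟩, ⟨hh.1, by rw [e₂, hd, hh.2, sub_zero]⟩⟩
  obtain ⟨N, hN⟩ := (hZ _ (isNormExposedFace_face hx ⟨f, hfx⟩)).exists_submodule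
  have m₁ : g₁ ∈ N := by
    rw [← SetLike.mem_coe, hN]; exact orthCompl_anti (fun h hh => (hsub h hh).1) hg₁
  have m₂ : g₂ ∈ N := by
    rw [← SetLike.mem_coe, hN]; exact orthCompl_anti (fun h hh => (hsub h hh).2) hg₂
  have m : g₁ + c • g₂ ∈ (N : Set Z) := N.add_mem m₁ (N.smul_mem c m₂)
  rw [hN] at m
  exact m f hfx

theorem IsWFS.orth_add_smul (hZ : IsWFS Z) {f g₁ g₂ : Z} (h₁ : Orth f g₁) (h₂ : Orth f g₂)
    (c : ℂ) : Orth f (g₁ + c • g₂) := by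
  rcases eq_or_ne f 0 with rfl | hf
  · exact orth_zero_left _
  have hn : ‖f‖ ≠ 0 := norm_ne_zero_iff.2 hf
  have hk : ‖((‖f‖⁻¹ : ℝ) : ℂ) • f‖ = 1 := by
    rw [norm_smul, Complex.norm_real, norm_inv, norm_norm, inv_mul_cancel₀ hn]
  have hs : ∀ {g}, Orth f g → Orth (((‖f‖⁻¹ : ℝ) : ℂ) • f) g := fun h =>
    (h.symm.smul_right (by positivity)).symm
  have h := ((hZ.orth_add_smul_of_norm_eq_one hk (hs h₁) (hs h₂) c).symm.smul_right
    (norm_nonneg f)).symm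
  rwa [smul_smul, ← Complex.ofReal_mul, mul_inv_cancel₀ hn, Complex.ofReal_one, one_smul] at h

theorem IsWFS.orth_of_mem_closedSpan (hZ : IsWFS Z) {F : Set Z} {f g : Z} (hf : f ∈ closedSpan F)
    (hg : g ∈ orthCompl F) : Orth f g := by
  have hz : Orth g 0 := (orth_zero_left g).symm
  let M : Submodule ℂ Z :=
    { carrier := {k | Orth g k}
      zero_mem' := hz
      add_mem' := fun {a b} ha hb => by simpa using hZ.orth_add_smul ha hb 1
      smul_mem' := fun c a ha => by simpa using hZ.orth_add_smul hz ha c }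
  have hle : closedSpan F ≤ M :=
    Submodule.topologicalClosure_minimal _ (Submodule.span_le.2 fun k hk => (hg k hk).symm)
      (isClosed_setOf_orth g)
  exact (hle hf : Orth g f).symm

section Peirce

variable {F : Set Z}

theorem IsSymmetricFace.involutive (hF : IsSymmetricFace F) (z : Z) :
    faceSymmetry F (faceSymmetry F z) = z :=
  (isFacialSymmetry_faceSymmetry hF).involutive z

theorem IsSymmetricFace.peirceTwo_mem (hF : IsSymmetricFace F) (z : Z) :
    peirceTwo F z ∈ closedSpan F := by
  rw [← SetLike.mem_coe, ← (isPeircePair_peirce hF).range_two]; exact ⟨z, rfl⟩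

theorem IsSymmetricFace.peirceZero_mem (hF : IsSymmetricFace F) (z : Z) :
    peirceZero F z ∈ orthCompl F := by
  rw [← (isPeircePair_peirce hF).range_zero]; exact ⟨z, rfl⟩

theorem IsSymmetricFace.peirceTwo_of_mem (hF : IsSymmetricFace F) {a : Z} (ha : a ∈ closedSpan F) :
    peirceTwo F a = a := by
  rw [← SetLike.mem_coe, ← (isPeircePair_peirce hF).range_two] at ha
  obtain ⟨z, rfl⟩ := ha
  exact (isPeircePair_peirce hF).proj_two z

theorem IsSymmetricFace.peirceZero_of_mem (hF : IsSymmetricFace F) {n : Z} (hn : n ∈ orthCompl F) :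
    peirceZero F n = n := by
  rw [← (isPeircePair_peirce hF).range_zero] at hn
  obtain ⟨z, rfl⟩ := hn
  exact (isPeircePair_peirce hF).proj_zero z

theorem IsSymmetricFace.sum (hF : IsSymmetricFace F) (z : Z) :
    peirceTwo F z + peirceZero F z = (2⁻¹ : ℂ) • (z + faceSymmetry F z) :=
  (isPeircePair_peirce hF).sum z

theorem IsSymmetricFace.symm_of_mem_closedSpan (hF : IsSymmetricFace F) {a : Z}
    (ha : a ∈ closedSpan F) : faceSymmetry F a = a := by
  obtain ⟨N, -, -, h, -⟩ := (isFacialSymmetry_faceSymmetry hF).fixed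
  exact (h a).2 (Submodule.mem_sup_left ha)

theorem IsSymmetricFace.symm_of_mem_orthCompl (hF : IsSymmetricFace F) {n : Z}
    (hn : n ∈ orthCompl F) : faceSymmetry F n = n := by
  obtain ⟨N, hN, -, h, -⟩ := (isFacialSymmetry_faceSymmetry hF).fixed
  rw [← hN] at hn
  exact (h n).2 (Submodule.mem_sup_right hn)

theorem IsSymmetricFace.sum_of_fixed (hF : IsSymmetricFace F) {z : Z}
    (hz : faceSymmetry F z = z) : peirceTwo F z + peirceZero F z = z := by
  rw [hF.sum, hz, ← two_smul ℂ z, smul_smul]; norm_num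

theorem IsSymmetricFace.peirceZero_of_mem_closedSpan (hF : IsSymmetricFace F) {a : Z}
    (ha : a ∈ closedSpan F) : peirceZero F a = 0 := by
  have h := hF.sum_of_fixed (hF.symm_of_mem_closedSpan ha)
  rw [hF.peirceTwo_of_mem ha] at h
  simpa using h

theorem IsSymmetricFace.peirceTwo_of_mem_orthCompl (hF : IsSymmetricFace F) {n : Z}
    (hn : n ∈ orthCompl F) : peirceTwo F n = 0 := by
  have h := hF.sum_of_fixed (hF.symm_of_mem_orthCompl hn)
  rw [hF.peirceZero_of_mem hn] at h
  simpa using h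

theorem IsSymmetricFace.peirceZero_symm (hF : IsSymmetricFace F) (z : Z) :
    peirceZero F (faceSymmetry F z) = peirceZero F z := by
  have h : faceSymmetry F z = (2 : ℂ) • (peirceTwo F z + peirceZero F z) - z := by
    rw [hF.sum, smul_smul]; norm_num
  rw [h, map_sub, map_smul, map_add, hF.peirceZero_of_mem_closedSpan (hF.peirceTwo_mem z),
    hF.peirceZero_of_mem (hF.peirceZero_mem z), zero_add, two_smul]
  abel

theorem IsSymmetricFace.apply_symm (hF : IsSymmetricFace F) {y : StrongDual ℂ Z}
    (hy : ∀ z, y (peirceZero F z) = y z) (z : Z) : y (faceSymmetry F z) = y z := by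
  rw [← hy, hF.peirceZero_symm, hy]

/-- `P₂(F)Z` and `P₀(F)Z` form an `ℓ¹`-sum onto which `(I + S_F) / 2` is a contractive
projection. -/
theorem IsWFS.norm_peirceTwo_add_norm_peirceZero_le (hZ : IsWFS Z) (hF : IsSymmetricFace F)
    (z : Z) : ‖peirceTwo F z‖ + ‖peirceZero F z‖ ≤ ‖z‖ := by
  rw [← (hZ.orth_of_mem_closedSpan (hF.peirceTwo_mem z) (hF.peirceZero_mem z)).1, hF.sum, norm_smul]
  have := norm_add_le z (faceSymmetry F z)
  rw [(faceSymmetry F).norm_map] at this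
  norm_num
  linarith

theorem IsWFS.norm_peirceZero_le (hZ : IsWFS Z) (hF : IsSymmetricFace F) : ‖peirceZero F‖ ≤ 1 :=
  ContinuousLinearMap.opNorm_le_bound _ zero_le_one fun z => by
    have h := hZ.norm_peirceTwo_add_norm_peirceZero_le hF z
    have h2 := norm_nonneg (peirceTwo F z)
    linarith

end Peirce

end Symmetric

/-! ### Orthogonal geometric tripotents -/

section Tripotents

variable {Z : Type*} [NormedAddCommGroup Z] [NormedSpace ℂ Z]

theorem TripotentOrth.apply_peirceZero {u v : StrongDual ℂ Z} (hv : IsSymmetricFace (face v))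
    (h : TripotentOrth u v) (z : Z) : u (peirceZero (face v) z) = u z := by
  obtain ⟨w, rfl⟩ := h
  change w (peirceZero (face v) (peirceZero (face v) z)) = w (peirceZero (face v) z)
  rw [hv.peirceZero_of_mem (hv.peirceZero_mem z)]

theorem IsGeometricTripotent.apply_peirceTwo {v : StrongDual ℂ Z} (hv : IsGeometricTripotent v)
    (z : Z) : v (peirceTwo (face v) z) = v z := by
  have h : v (peirceTwo (face v) z + peirceZero (face v) z) = v z := by
    rw [hv.2.1.sum, map_smul, map_add, hv.2.2, smul_eq_mul]; ring
  rwa [map_add, hv.1.2 _ (hv.2.1.peirceZero_mem z), add_zero] at h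

/-- A geometric tripotent `v` and a functional in the unit ball of `U₀(v)` have a contractive
sum. -/
theorem IsWFS.norm_tripotent_add_le (hZ : IsWFS Z) {v w : StrongDual ℂ Z}
    (hv : IsGeometricTripotent v) (hw : ‖w‖ ≤ 1) (h : ∀ z, w (peirceZero (face v) z) = w z) :
    ‖v + w‖ ≤ 1 :=
  ContinuousLinearMap.opNorm_le_bound _ zero_le_one fun z => by
    have h1 : ‖v (peirceTwo (face v) z)‖ ≤ ‖peirceTwo (face v) z‖ := by
      simpa using v.le_of_opNorm_le hv.1.1.le (peirceTwo (face v) z)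
    have h2 : ‖w (peirceZero (face v) z)‖ ≤ ‖peirceZero (face v) z‖ := by
      simpa using w.le_of_opNorm_le hw (peirceZero (face v) z)
    rw [hv.apply_peirceTwo] at h1
    rw [h] at h2
    have h3 := hZ.norm_peirceTwo_add_norm_peirceZero_le hv.2.1 z
    rw [one_mul, add_apply]
    exact (norm_add_le _ _).trans ((add_le_add h1 h2).trans h3)

theorem IsWFS.face_subset_orthCompl (hZ : IsWFS Z) {u v : StrongDual ℂ Z}
    (hu : IsGeometricTripotent u) (hv : IsGeometricTripotent v)
    (h : ∀ z, u (peirceZero (face v) z) = u z) : face u ⊆ orthCompl (face v) := by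
  have h1 := hZ.norm_tripotent_add_le hv hu.1.1.le h
  have h2 := hZ.norm_tripotent_add_le hv (w := -u) (by rw [norm_neg, hu.1.1])
    fun z => by simp [h]
  refine face_subset_orthCompl_face hu.1.1.le hv.1.1.le (by rwa [add_comm]) ?_
  rwa [norm_sub_rev, sub_eq_add_neg]

theorem mem_orthCompl_of_isometry {F : Set Z} (T : Z ≃ₗᵢ[ℂ] Z) (hinv : ∀ z, T (T z) = z)
    (hT : ∀ z ∈ F, T z ∈ F) {g : Z} (hg : g ∈ orthCompl F) : T g ∈ orthCompl F := by
  intro f hf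
  have h : Orth (T (T f)) (T g) := by
    unfold Orth
    rw [← map_add, ← map_sub, T.norm_map (T f + g), T.norm_map (T f - g), T.norm_map (T f),
      T.norm_map g]
    exact hg _ (hT f hf)
  rwa [hinv] at h

theorem mem_closedSpan_of_isometry {F : Set Z} (T : Z ≃ₗᵢ[ℂ] Z)
    (hT : ∀ z ∈ F, T z ∈ F) {a : Z} (ha : a ∈ closedSpan F) : T a ∈ closedSpan F := by
  have hle : closedSpan F ≤ (closedSpan F).comap T.toLinearEquiv.toLinearMap := by
    refine Submodule.topologicalClosure_minimal _ (Submodule.span_le.2 fun k hk => ?_) ?_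
    · exact Submodule.le_topologicalClosure _ (Submodule.subset_span (hT k hk))
    · exact (Submodule.isClosed_topologicalClosure _).preimage T.continuous
  exact hle ha

/-- An isometric involution preserving a symmetric face commutes with the symmetry of that face,
since the conjugate symmetry is also a symmetry of the face. -/
theorem IsSymmetricFace.symm_comm {F : Set Z} (hF : IsSymmetricFace F) (T : Z ≃ₗᵢ[ℂ] Z)
    (hinv : ∀ z, T (T z) = z) (hT : ∀ z ∈ F, T z ∈ F) (z : Z) :
    faceSymmetry F (T z) = T (faceSymmetry F z) := by
  have hS := isFacialSymmetry_faceSymmetry hF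
  have hconj : IsFacialSymmetry F ((T.trans (faceSymmetry F)).trans T) := by
    obtain ⟨N, hN, hdis, hfix, hC⟩ := hS.fixed
    have hNT : ∀ n ∈ N, T n ∈ N := fun n hn => by
      rw [← SetLike.mem_coe, hN] at hn ⊢
      exact mem_orthCompl_of_isometry T hinv hT hn
    have hsup : ∀ z ∈ closedSpan F ⊔ N, T z ∈ closedSpan F ⊔ N := by
      intro z hz
      obtain ⟨a, ha, n, hn, rfl⟩ := Submodule.mem_sup.1 hz
      rw [map_add]
      exact Submodule.add_mem_sup (mem_closedSpan_of_isometry T hT ha) (hNT n hn)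
    refine ⟨fun z => ?_, N, hN, hdis, fun z => ?_, hC⟩
    · simp only [LinearIsometryEquiv.trans_apply]
      rw [hinv, hF.involutive, hinv]
    · simp only [LinearIsometryEquiv.trans_apply]
      constructor
      · intro h
        have h1 : faceSymmetry F (T z) = T z := by rw [← hinv (faceSymmetry F (T z)), h]
        have h2 := hsup _ ((hfix _).1 h1)
        rwa [hinv] at h2
      · intro h
        rw [(hfix _).2 (hsup z h), hinv]
  have h := congrArg (fun S : Z ≃ₗᵢ[ℂ] Z => S z) (hconj.unique hS)
  simp only [LinearIsometryEquiv.trans_apply] at h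
  rw [← h, hinv]

theorem IsSymmetricFace.peirceTwo_comm {F : Set Z} (hF : IsSymmetricFace F) (T : Z ≃ₗᵢ[ℂ] Z)
    (hinv : ∀ z, T (T z) = z) (hT : ∀ z ∈ F, T z ∈ F) (z : Z) :
    peirceTwo F (T z) = T (peirceTwo F z) := by
  have hE : T (peirceTwo F z) + T (peirceZero F z) = peirceTwo F (T z) + peirceZero F (T z) := by
    rw [← map_add, hF.sum, hF.sum, map_smul, map_add, hF.symm_comm T hinv hT]
  have h := congrArg (peirceTwo F) hE
  rwa [map_add, map_add, hF.peirceTwo_of_mem (hF.peirceTwo_mem _),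
    hF.peirceTwo_of_mem_orthCompl (hF.peirceZero_mem _),
    hF.peirceTwo_of_mem (mem_closedSpan_of_isometry T hT (hF.peirceTwo_mem z)),
    hF.peirceTwo_of_mem_orthCompl
      (mem_orthCompl_of_isometry T hinv hT (hF.peirceZero_mem z)),
    add_zero, add_zero, eq_comm] at h

/-- Orthogonal geometric tripotents have commuting Peirce `0`-projections. Since
`P₀ = (I + S) / 2 - P₂`, this follows from `P₂(u) P₂(v) = 0 = P₂(v) P₂(u)` and from `S_v`, which
fixes `u` and so preserves `F_u`, commuting with `S_u` and `P₂(u)`. -/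
theorem IsWFS.commute_peirceZero (hZ : IsWFS Z) {u v : StrongDual ℂ Z}
    (hu : IsGeometricTripotent u) (hv : IsGeometricTripotent v)
    (huv : TripotentOrth u v) (hvu : TripotentOrth v u) :
    Commute (peirceZero (face u)) (peirceZero (face v)) := by
  have hu0 := huv.apply_peirceZero hv.2.1
  have hv0 := hvu.apply_peirceZero hu.2.1
  -- If `y` is fixed by a symmetry, then the symmetry preserves the face exposed by `y`.
  have hpres : ∀ {y w : StrongDual ℂ Z}, (∀ z, y (faceSymmetry (face w) z) = y z) →
      ∀ z ∈ face y, faceSymmetry (face w) z ∈ face y := fun h z hz =>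
    ⟨by rw [LinearIsometryEquiv.norm_map]; exact hz.1, by rw [h]; exact hz.2⟩
  have hTu := hpres (hv.2.1.apply_symm hu0)
  have hTv := hpres (hu.2.1.apply_symm hv0)
  have hmem : ∀ {y w : StrongDual ℂ Z}, face y ⊆ orthCompl (face w) →
      IsSymmetricFace (face w) →
        closedSpan (face y) ≤ LinearMap.ker (peirceTwo (face w)).toLinearMap := by
    intro y w hyw hw
    refine Submodule.topologicalClosure_minimal _ (Submodule.span_le.2 fun k hk => ?_) ?_
    · exact hw.peirceTwo_of_mem_orthCompl (hyw hk)
    · exact (peirceTwo (face w)).isClosed_ker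
  have hzuv : ∀ z, peirceTwo (face v) (peirceTwo (face u) z) = 0 := fun z =>
    hmem (hZ.face_subset_orthCompl hu hv hu0) hv.2.1 (hu.2.1.peirceTwo_mem z)
  have hzvu : ∀ z, peirceTwo (face u) (peirceTwo (face v) z) = 0 := fun z =>
    hmem (hZ.face_subset_orthCompl hv hu hv0) hu.2.1 (hv.2.1.peirceTwo_mem z)
  have hP0 : ∀ {F : Set Z}, IsSymmetricFace F → ∀ z,
      peirceZero F z = (2⁻¹ : ℂ) • (z + faceSymmetry F z) - peirceTwo F z := fun hF z => by
    rw [← hF.sum]; abel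
  refine ContinuousLinearMap.ext fun z => ?_
  change peirceZero (face u) (peirceZero (face v) z) = peirceZero (face v) (peirceZero (face u) z)
  simp only [hP0 hu.2.1, hP0 hv.2.1, map_sub, map_add, map_smul, hzuv, hzvu,
    hu.2.1.symm_comm _ hv.2.1.involutive hTu, hu.2.1.peirceTwo_comm _ hv.2.1.involutive hTu,
    hv.2.1.peirceTwo_comm _ hu.2.1.involutive hTv]
  module

end Tripotents

/-! ### Finite products and weak-star sums -/

section Families

variable {Z : Type*} [NormedAddCommGroup Z] [NormedSpace ℂ Z]

/-- If `v` lies in the dual unit ball and in all `U₀(u_i)`, then its sum with finitely many of the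
`u_i` is contractive. -/
theorem IsWFS.norm_sum_add_le (hZ : IsWFS Z) {ι : Type*} {u : ι → StrongDual ℂ Z}
    (hu : ∀ i, IsGeometricTripotent (u i)) (horth : ∀ i j, i ≠ j → TripotentOrth (u i) (u j))
    {v : StrongDual ℂ Z} (hv : ‖v‖ ≤ 1) (h : ∀ i z, v (peirceZero (face (u i)) z) = v z)
    (A : Finset ι) : ‖∑ i ∈ A, u i + v‖ ≤ 1 := by
  classical
  induction A using Finset.induction_on with
  | empty => simpa using hv
  | insert i A hi ih =>
    rw [Finset.sum_insert hi, add_assoc]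
    refine hZ.norm_tripotent_add_le (hu i) ih fun z => ?_
    simp only [add_apply, sum_apply, h]
    congr 1
    refine Finset.sum_congr rfl fun j hj => ?_
    exact (horth j i (by rintro rfl; exact hi hj)).apply_peirceZero (hu i).2.1 z

/-- The weak-star sum `s` of an orthogonal family of geometric tripotents: it exposes a face
containing all the `F_{u_i}`, and the sum of `s` with any functional in the dual unit ball which
lies in all `U₀(u_i)` is contractive. -/
theorem IsWFS.exists_weakStar_sum (hZ : IsWFS Z) {ι : Type*} {u : ι → StrongDual ℂ Z}
    (hu : ∀ i, IsGeometricTripotent (u i)) (horth : ∀ i j, i ≠ j → TripotentOrth (u i) (u j)) :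
    ∃ s : StrongDual ℂ Z, ‖s‖ ≤ 1 ∧ (∀ i, face (u i) ⊆ face s) ∧
      ∀ v : StrongDual ℂ Z, ‖v‖ ≤ 1 → (∀ i z, v (peirceZero (face (u i)) z) = v z) →
        ‖s + v‖ ≤ 1 := by
  let l : Ultrafilter (Finset ι) := Ultrafilter.of atTop
  have hl : (l : Filter (Finset ι)) ≤ atTop := Ultrafilter.of_le _
  obtain ⟨s, hs, hlim⟩ := exists_weakStar_limit l (fun A => ∑ i ∈ A, u i) fun A => by
    simpa using hZ.norm_sum_add_le hu horth (v := 0) (by simp) (by simp) A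
  refine ⟨s, hs, fun i f hf => ⟨hf.1, ?_⟩, fun v hv h => ?_⟩
  · refine tendsto_nhds_unique (hlim f) (tendsto_const_nhds.congr' ?_)
    filter_upwards [hl (eventually_ge_atTop {i})] with A hA
    rw [sum_apply, Finset.sum_eq_single_of_mem i (hA (Finset.mem_singleton_self i)), hf.2]
    intro j _ hji
    rw [← (horth j i hji).apply_peirceZero (hu i).2.1, (hu i).2.1.peirceZero_of_mem_closedSpan
      (Submodule.le_topologicalClosure _ (Submodule.subset_span hf)), map_zero]
  · refine ContinuousLinearMap.opNorm_le_bound _ zero_le_one fun z => ?_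
    refine le_of_tendsto ((hlim z).add_const (v z)).norm (Eventually.of_forall fun A => ?_)
    simpa using (∑ i ∈ A, u i + v).le_of_opNorm_le (hZ.norm_sum_add_le hu horth hv h A) z

/-- A functional `v` with `s ± v` contractive satisfies `v = v ∘ P₀(F_s)`: it vanishes on `F_s`,
and strong facial symmetry makes both `s` and `s + v` invariant under the symmetry of `F_s`. -/
theorem IsSFS.apply_peirceZero_of_norm_add_sub_le (hZ : IsSFS Z) {s v : StrongDual ℂ Z}
    (hs : ‖s‖ ≤ 1) (hne : (face s).Nonempty) (hadd : ‖s + v‖ ≤ 1) (hsub : ‖s - v‖ ≤ 1) (z : Z) :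
    v (peirceZero (face s) z) = v z := by
  have hexp := isNormExposedFace_face hs hne
  have hF := hZ.1 _ hexp
  have h0 : ∀ f ∈ face s, v f = 0 := fun f hf => apply_eq_zero_of_mem_face hadd hsub hf
  have hface : face s ⊆ face (s + v) := fun f hf =>
    ⟨hf.1, by rw [add_apply, hf.2, h0 f hf, add_zero]⟩
  have h1 := hZ.2 _ hexp s (norm_eq_one_of_face_nonempty hs hne) subset_rfl z
  have h2 := hZ.2 _ hexp (s + v) (norm_eq_one_of_face_nonempty hadd (hne.mono hface)) hface z
  rw [add_apply, add_apply, h1, add_right_inj] at h2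
  have h3 : closedSpan (face s) ≤ LinearMap.ker v.toLinearMap :=
    Submodule.topologicalClosure_minimal _ (Submodule.span_le.2 h0) v.isClosed_ker
  have h4 : v (peirceTwo (face s) z) = 0 := h3 (hF.peirceTwo_mem z)
  have h5 := congrArg v (hF.sum z)
  rw [map_add, h4, zero_add, map_smul, map_add, h2, smul_eq_mul] at h5
  rw [h5]; ring

theorem noncommProd_comp_of_mem {ι : Type*} (A : Finset ι) (P : ι → Z →L[ℂ] Z)
    (hcomm : ∀ i j, Commute (P i) (P j)) (hP : ∀ i z, P i (P i z) = P i z) {i : ι} (hi : i ∈ A)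
    (z : Z) : A.noncommProd P (fun i _ j _ _ => hcomm i j) (P i z) =
      A.noncommProd P (fun i _ j _ _ => hcomm i j) z := by
  classical
  rw [← Finset.noncommProd_erase_mul A hi P fun i _ j _ _ => hcomm i j]
  exact congrArg (DFunLike.coe (Finset.noncommProd _ P _)) (hP i z)

theorem noncommProd_apply_of_fixed {ι : Type*} (A : Finset ι) (P : ι → Z →L[ℂ] Z)
    (hcomm : ∀ i j, Commute (P i) (P j)) {z : Z} (hz : ∀ i, P i z = z) :
    A.noncommProd P (fun i _ j _ _ => hcomm i j) z = z :=
  Finset.noncommProd_induction A P _ (fun T : Z →L[ℂ] Z => T z = z)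
    (fun S _ hS hT => (congrArg S hT).trans hS) rfl fun i _ => hz i

theorem norm_noncommProd_le_one {ι : Type*} (A : Finset ι) (P : ι → Z →L[ℂ] Z)
    (hcomm : ∀ i j, Commute (P i) (P j)) (hP : ∀ i, ‖P i‖ ≤ 1) :
    ‖A.noncommProd P (fun i _ j _ _ => hcomm i j)‖ ≤ 1 :=
  Finset.noncommProd_induction A P _ (fun T : Z →L[ℂ] Z => ‖T‖ ≤ 1)
    (fun S T hS hT => (ContinuousLinearMap.opNorm_comp_le S T).trans
      (mul_le_one₀ hS (norm_nonneg _) hT))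
    ContinuousLinearMap.norm_id_le fun i _ => hP i

/-- Finite products of commuting contractive projections tend to zero at `h` as soon as every
functional of norm at most one invariant under all of the projections vanishes at `h`: a weak-star
limit of functionals norming the products at `h` is invariant. -/
theorem tendsto_noncommProd_zero {ι : Type*} (P : ι → Z →L[ℂ] Z)
    (hcomm : ∀ i j, Commute (P i) (P j)) (hP : ∀ i z, P i (P i z) = P i z) (hn : ∀ i, ‖P i‖ ≤ 1)
    {h : Z} (hh : ∀ v : StrongDual ℂ Z, ‖v‖ ≤ 1 → (∀ i z, v (P i z) = v z) → v h = 0) :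
    Tendsto (fun A : Finset ι => A.noncommProd P (fun i _ j _ _ => hcomm i j) h) atTop (𝓝 0) := by
  set R : Finset ι → Z →L[ℂ] Z := fun A => A.noncommProd P (fun i _ j _ _ => hcomm i j) with hR
  rw [tendsto_zero_iff_norm_tendsto_zero, tendsto_iff_ultrafilter]
  intro l hl
  choose φ hφ hφR using fun A => exists_dual_vector'' ℂ (R A h)
  obtain ⟨v, hv, hlim⟩ := exists_weakStar_limit l (fun A => (φ A).comp (R A)) fun A =>
    ((φ A).opNorm_comp_le (R A)).trans
      (mul_le_one₀ (hφ A) (norm_nonneg _) (norm_noncommProd_le_one A P hcomm hn))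
  have hinv : ∀ i z, v (P i z) = v z := by
    intro i z
    refine tendsto_nhds_unique (hlim (P i z)) ((hlim z).congr' ?_)
    filter_upwards [hl (eventually_ge_atTop {i})] with A hA
    simp only [ContinuousLinearMap.comp_apply, hR]
    rw [noncommProd_comp_of_mem A P hcomm hP (hA (Finset.mem_singleton_self i))]
  have hlim0 := (hlim h).norm
  rw [hh v hv hinv, norm_zero] at hlim0
  refine hlim0.congr fun A => ?_
  rw [ContinuousLinearMap.comp_apply, hφR, RCLike.norm_ofReal, abs_norm]

end Families

end FacialSymmetry

theorem mainTheorem6 {Z : Type*} [NormedAddCommGroup Z] [NormedSpace ℂ Z]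
    (hSFS : FacialSymmetry.IsSFS Z) (hneutral : FacialSymmetry.IsNeutral Z)
    (hJP : FacialSymmetry.SatisfiesJP Z)
    {ι : Type*} (u : ι → StrongDual ℂ Z)
    (hmin : ∀ i, FacialSymmetry.IsMinimalTripotent (u i))
    (horth : ∀ i j, i ≠ j → FacialSymmetry.TripotentOrth (u i) (u j)) :
    ∃ hcomm : ∀ i j, Commute (FacialSymmetry.peirceZero (FacialSymmetry.face (u i)))
        (FacialSymmetry.peirceZero (FacialSymmetry.face (u j))),
      ∃ Q : Z →L[ℂ] Z,
        (∀ f : Z, Tendsto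
          (fun A : Finset ι =>
            A.noncommProd (fun i => FacialSymmetry.peirceZero (FacialSymmetry.face (u i)))
              (fun i _ j _ _ => hcomm i j) f)
          atTop (𝓝 (Q f))) ∧
        ‖Q‖ ≤ 1 ∧
        (∀ f : Z, Q (Q f) = Q f) ∧
        Set.range Q = ⋂ i, Set.range (FacialSymmetry.peirceZero (FacialSymmetry.face (u i))) := by
  open FacialSymmetry in
  have hu : ∀ i, IsGeometricTripotent (u i) := fun i => (hmin i).1
  have hF : ∀ i, IsSymmetricFace (face (u i)) := fun i => (hu i).2.1
  have hcomm : ∀ i j, Commute (peirceZero (face (u i))) (peirceZero (face (u j))) := by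
    intro i j
    rcases eq_or_ne i j with rfl | hij
    · exact Commute.refl _
    · exact hSFS.1.commute_peirceZero (hu i) (hu j) (horth i j hij) (horth j i hij.symm)
  refine ⟨hcomm, ?_⟩
  rcases isEmpty_or_nonempty ι with hι | ⟨⟨i₀⟩⟩
  -- The empty product is the identity; the sum of the `u_i` then exposes no face.
  · refine ⟨ContinuousLinearMap.id ℂ Z, fun f => ?_, ContinuousLinearMap.norm_id_le,
      fun f => rfl, by simp⟩
    exact tendsto_const_nhds.congr fun A =>
      (noncommProd_apply_of_fixed A _ hcomm fun i => isEmptyElim i).symm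
  obtain ⟨s, hs, hface, hsum⟩ := hSFS.1.exists_weakStar_sum hu horth
  have hne : (face s).Nonempty := (hF i₀).1.1.mono (hface i₀)
  have hFs : IsSymmetricFace (face s) := hSFS.1 _ (isNormExposedFace_face hs hne)
  have hidem : ∀ z, peirceZero (face s) (peirceZero (face s) z) = peirceZero (face s) z :=
    fun z => hFs.peirceZero_of_mem (hFs.peirceZero_mem z)
  have hfix : ∀ f i, peirceZero (face (u i)) (peirceZero (face s) f) = peirceZero (face s) f :=
    fun f i => (hF i).peirceZero_of_mem (orthCompl_anti (hface i) (hFs.peirceZero_mem f))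
  have hlim : ∀ f : Z, Tendsto (fun A : Finset ι =>
      A.noncommProd (fun i => peirceZero (face (u i))) (fun i _ j _ _ => hcomm i j) f)
      atTop (𝓝 (peirceZero (face s) f)) := by
    intro f
    have h := tendsto_noncommProd_zero (fun i => peirceZero (face (u i))) hcomm
      (fun i z => (hF i).peirceZero_of_mem ((hF i).peirceZero_mem z))
      (fun i => hSFS.1.norm_peirceZero_le (hF i)) (h := f - peirceZero (face s) f)
      fun v hv hinv => by
        have hsub : ‖s - v‖ ≤ 1 := by
          rw [sub_eq_add_neg]
          exact hsum (-v) (by rwa [norm_neg]) fun i z => by simp [hinv]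
        rw [← hSFS.apply_peirceZero_of_norm_add_sub_le hs hne (hsum v hv hinv) hsub, map_sub,
          hidem, sub_self, map_zero]
    have h2 := h.add_const (peirceZero (face s) f)
    rw [zero_add] at h2
    refine h2.congr fun A => ?_
    rw [map_sub, noncommProd_apply_of_fixed A _ hcomm (hfix f), sub_add_cancel]
  refine ⟨peirceZero (face s), hlim, hSFS.1.norm_peirceZero_le hFs, hidem, Set.ext fun g => ?_⟩
  simp only [Set.mem_iInter]
  constructor
  · rintro ⟨f, rfl⟩ i
    exact ⟨_, hfix f i⟩
  · intro hg
    have hg' : ∀ i, peirceZero (face (u i)) g = g := fun i => by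
      obtain ⟨f, rfl⟩ := hg i
      exact (hF i).peirceZero_of_mem ((hF i).peirceZero_mem f)
    refine ⟨g, tendsto_nhds_unique (hlim g) (tendsto_const_nhds.congr fun A => ?_)⟩
    exact (noncommProd_apply_of_fixed A _ hcomm hg').symm
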